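/- Let $G_1$ and $G_2$ be finite simple undirected graphs with adjacency matrices $A_1,A_2$ (entries in $\{0,1\}$), and suppose that they are isospectral, i.e. $A_1$ and $A_2$ have the same eigenvalues counted with multiplicity; let $M$ be the common number of vertices. Let $c>0$ satisfy $c\,\|A_1\|_2<1$, where $\|\cdot\|_2$ is the spectral norm (equivalently $c\,\|A_2\|_2<1$). For $G\in\{G_1,G_2\}$ with adjacency matrix $A$ put $$C_G=c\,(A\oplus A)\in\mathbb{R}^{2M\times 2M},\qquad X=\begin{bmatrix}0&\mathbb{I}_M\\ \mathbb{I}_M&0\end{bmatrix},\qquad \sigma_{Q,G}=(\mathbb{I}_{2M}-XC_G)^{-1},$$ and for every photon pattern $\boldsymbol n=(n_1,\dots,n_M)\in\mathbb{Z}_{\ge0}^M$ let $$p_G(\boldsymbol n)=\frac{1}{n_1!\cdots n_M!\,\sqrt{\det\sigma_{Q,G}}}\;\prod_{i=1}^M\frac{\partial^{n_i}}{\partial\beta_i^{n_i}}\frac{\partial^{n_i}}{\partial\bar\beta_i^{n_i}}\;e^{\frac12\boldsymbol\gamma^\top C_G\boldsymbol\gamma}\Big|_{\boldsymbol\gamma=0},\qquad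 \boldsymbol\gamma=(\beta_1,\dots,\beta_M,\bar\beta_1,\dots,\bar\beta_M),$$ where $\beta_i,\bar\beta_i$ are treated as $2M$ independent variables. This is the probability of detecting the pattern $\boldsymbol n$ in the Gaussian boson sampling device encoding $G$. For $N\in\mathbb{Z}_{\ge0}$ let $$p_G(N)=\sum_{\boldsymbol n\in\mathbb{Z}_{\ge0}^M,\; n_1+\dots+n_M=N}p_G(\boldsymbol n)$$ be the coarse-grained probability of total photon number $N$. Then $$p_{G_1}(N)=p_{G_2}(N)\qquad\text{for all } N\in\mathbb{Z}_{\ge0}.$$ -/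

import Mathlib

open scoped Matrix Nat

noncomputable section

namespace GBS

/-- The matrix `X = [[0, 1], [1, 0]]` exchanging the two halves of `V ⊕ V`. -/
def swapMatrix (V : Type*) [DecidableEq V] : Matrix (V ⊕ V) (V ⊕ V) ℝ :=
  Matrix.fromBlocks 0 1 1 0

/-- The matrix `σ_Q = (1 - X C)⁻¹`. -/
def sigmaQ {V : Type*} [Fintype V] [DecidableEq V] (C : Matrix (V ⊕ V) (V ⊕ V) ℝ) :
    Matrix (V ⊕ V) (V ⊕ V) ℝ :=
  (1 - swapMatrix V * C)⁻¹

/-- The partial derivative `∂f/∂x_i` of a function of the real variables `(x_i)`. -/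
def partialDeriv {ι : Type*} [DecidableEq ι] (i : ι) (f : (ι → ℝ) → ℝ) : (ι → ℝ) → ℝ :=
  fun x => lineDeriv ℝ f x (Pi.single i 1)

/-- The mixed partial derivative `∏ i, ∂_i ^ (m i)` of `f`. The variables are taken in some order
(an enumeration of the finite type `ι`), which is immaterial for smooth `f`. -/
def mixedPartial {ι : Type*} [Fintype ι] [DecidableEq ι] (m : ι → ℕ) (f : (ι → ℝ) → ℝ) :
    (ι → ℝ) → ℝ :=
  (Finset.univ : Finset ι).toList.foldr (fun i g => (partialDeriv i)^[m i] g) f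

/-- The probability of the detection event `n` for the matrix `C`, whose rows and columns are
indexed by the variables `γ = (β, β̄)`: the left copy of `V` carries the variables `β_i`, the right
copy the (independent) variables `β̄_i`, and
`p(n) = (n! √(det σ_Q))⁻¹ ∏ i, ∂_{β_i}^{n_i} ∂_{β̄_i}^{n_i} exp (γᵀ C γ / 2)` at `γ = 0`. -/
def detectionProb {V : Type*} [Fintype V] [DecidableEq V] (C : Matrix (V ⊕ V) (V ⊕ V) ℝ)
    (n : V → ℕ) : ℝ :=
  1 / (((∏ i, (n i)! : ℕ) : ℝ) * √(sigmaQ C).det) *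
    mixedPartial (Sum.elim n n) (fun γ => Real.exp (1 / 2 * (γ ⬝ᵥ (C *ᵥ γ)))) 0

/-- The matrix `C = c (A ⊕ A)` encoding the graph `G` with adjacency matrix `A`. -/
def encoding {V : Type*} [DecidableEq V] (G : SimpleGraph V) [DecidableRel G.Adj] (c : ℝ) :
    Matrix (V ⊕ V) (V ⊕ V) ℝ :=
  c • Matrix.fromBlocks (G.adjMatrix ℝ) 0 0 (G.adjMatrix ℝ)

/-- The coarse-grained probability `p_G(N)`: the sum of `p(n)` over all detection events
`n : V → ℕ` with total photon number `∑ i, n i = N`. -/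
def coarseProb {V : Type*} [Fintype V] [DecidableEq V] (G : SimpleGraph V) [DecidableRel G.Adj]
    (c : ℝ) (N : ℕ) : ℝ :=
  ∑ n ∈ Finset.piAntidiag (Finset.univ : Finset V) N, detectionProb (encoding G c) n

/-- Two graphs are isospectral if their adjacency matrices have the same eigenvalues, counted with
multiplicity (all of them are real). -/
def Isospectral {V W : Type*} [Fintype V] [DecidableEq V] [Fintype W] [DecidableEq W]
    (G : SimpleGraph V) [DecidableRel G.Adj] (H : SimpleGraph W) [DecidableRel H.Adj] : Prop :=
  (G.adjMatrix ℝ).charpoly.roots = (H.adjMatrix ℝ).charpoly.roots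

/-- The spectral norm `‖A‖₂` of the adjacency matrix of `G`. -/
def spectralNorm {V : Type*} [Fintype V] [DecidableEq V] (G : SimpleGraph V)
    [DecidableRel G.Adj] : ℝ :=
  ‖Matrix.toEuclideanCLM (n := V) (𝕜 := ℝ) (G.adjMatrix ℝ)‖

end GBS

end

/-! Write `F x = exp (xᵀ A x / 2)` with `A` the scaled adjacency matrix. As `C = A ⊕ A`, the
exponential splits into a copy of `F` in each half of the variables, and `p(n)` is a prefactor times
`(∂ⁿF(0))² / n!`. Since `N!/n!` counts the words of length `N` with letter counts `n`, the sum over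
all patterns is `1/N!` times the sum of squares of all entries of the `N`-th derivative tensor of
`F` at 0 (`sum_detectionProb_fromBlocks`). This squared Frobenius norm is invariant under orthogonal
changes of variables (`sum_sq_comp_orthogonal`), and isospectral symmetric matrices are orthogonally
conjugate. The prefactor depends only on `det (1 - A²)`, which conjugation preserves. -/

namespace GBS

/-! ### Mixed partial derivatives as entries of the iterated derivative. -/

section Derivatives

variable {ι : Type*} [DecidableEq ι]

/-- The iterated partial derivative of `f` along a list of variables. -/
noncomputable def listPartial (l : List ι) (f : (ι → ℝ) → ℝ) : (ι → ℝ) → ℝ :=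
  l.foldr partialDeriv f

@[simp] lemma listPartial_nil (f : (ι → ℝ) → ℝ) : listPartial [] f = f := rfl

@[simp] lemma listPartial_cons (i : ι) (l : List ι) (f : (ι → ℝ) → ℝ) :
    listPartial (i :: l) f = partialDeriv i (listPartial l f) := rfl

lemma listPartial_append (l₁ l₂ : List ι) (f : (ι → ℝ) → ℝ) :
    listPartial (l₁ ++ l₂) f = listPartial l₁ (listPartial l₂ f) := by
  simp [listPartial]

lemma listPartial_replicate (k : ℕ) (i : ι) (f : (ι → ℝ) → ℝ) :
    listPartial (List.replicate k i) f = (partialDeriv i)^[k] f := by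
  induction k with
  | zero => rfl
  | succ k ih => rw [List.replicate_succ, listPartial_cons, ih, Function.iterate_succ_apply']

/-- A list of variables in which `i` occurs `m i` times. -/
noncomputable def variableList [Fintype ι] (m : ι → ℕ) : List ι :=
  (Finset.univ : Finset ι).toList.flatMap fun i => List.replicate (m i) i

lemma mixedPartial_eq_listPartial [Fintype ι] (m : ι → ℕ) (f : (ι → ℝ) → ℝ) :
    mixedPartial m f = listPartial (variableList m) f := by
  unfold mixedPartial variableList
  induction (Finset.univ : Finset ι).toList with
  | nil => rfl
  | cons i l ih =>
    rw [List.foldr_cons, ih, List.flatMap_cons, listPartial_append, listPartial_replicate]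

lemma count_variableList [Fintype ι] (m : ι → ℕ) (i : ι) : (variableList m).count i = m i := by
  rw [variableList, List.count_flatMap, Finset.sum_map_toList]
  simp [List.count_replicate]

lemma variableList_perm [Fintype ι] {m : ι → ℕ} {l : List ι}
    (h : ∀ i, l.countP (fun j => decide (j = i)) = m i) : (variableList m).Perm l :=
  List.perm_iff_count.2 fun i => (count_variableList m i).trans (h i).symm

variable [Fintype ι]

lemma partialDeriv_eq_fderiv {f : (ι → ℝ) → ℝ} (hf : ContDiff ℝ ⊤ f) (i : ι) :
    partialDeriv i f = fun x => fderiv ℝ f x (Pi.single i 1) := by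
  ext x
  exact (hf.differentiable (by simp) x).lineDeriv_eq_fderiv

lemma contDiff_partialDeriv {f : (ι → ℝ) → ℝ} (hf : ContDiff ℝ ⊤ f) (i : ι) :
    ContDiff ℝ ⊤ (partialDeriv i f) := by
  rw [partialDeriv_eq_fderiv hf]
  exact (hf.fderiv_right (m := ⊤) (by simp)).clm_apply contDiff_const

lemma contDiff_listPartial {f : (ι → ℝ) → ℝ} (hf : ContDiff ℝ ⊤ f) (l : List ι) :
    ContDiff ℝ ⊤ (listPartial l f) := by
  induction l with
  | nil => exact hf
  | cons i l ih => exact contDiff_partialDeriv ih i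

/-- Both sides are values of the second Fréchet derivative, which is symmetric. -/
lemma partialDeriv_comm {f : (ι → ℝ) → ℝ} (hf : ContDiff ℝ ⊤ f) (i j : ι) :
    partialDeriv i (partialDeriv j f) = partialDeriv j (partialDeriv i f) := by
  have hd : Differentiable ℝ (fderiv ℝ f) :=
    (hf.fderiv_right (m := ⊤) (by simp)).differentiable (by simp)
  have key (i j : ι) (x : ι → ℝ) : partialDeriv i (partialDeriv j f) x =
      fderiv ℝ (fderiv ℝ f) x (Pi.single i 1) (Pi.single j 1) := by
    rw [partialDeriv_eq_fderiv (contDiff_partialDeriv hf j), partialDeriv_eq_fderiv hf]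
    simp [fderiv_clm_apply (hd x) (differentiableAt_const _)]
  ext x
  rw [key, key]
  exact (hf.contDiffAt.isSymmSndFDerivAt (by simp)).eq _ _

lemma listPartial_perm {f : (ι → ℝ) → ℝ} (hf : ContDiff ℝ ⊤ f) {l₁ l₂ : List ι}
    (h : l₁.Perm l₂) : listPartial l₁ f = listPartial l₂ f := by
  induction h with
  | nil => rfl
  | cons i _ ih => rw [listPartial_cons, listPartial_cons, ih]
  | swap i j l => exact partialDeriv_comm (contDiff_listPartial hf l) j i
  | trans _ _ ih₁ ih₂ => exact ih₁.trans ih₂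

lemma listPartial_ofFn {f : (ι → ℝ) → ℝ} (hf : ContDiff ℝ ⊤ f) {N : ℕ} (i : Fin N → ι)
    (x : ι → ℝ) :
    listPartial (List.ofFn i) f x = iteratedFDeriv ℝ N f x fun k => Pi.single (i k) 1 := by
  induction N generalizing x with
  | zero => simp
  | succ N ih =>
    have hd : DifferentiableAt ℝ (iteratedFDeriv ℝ N f) x :=
      hf.differentiable_iteratedFDeriv (by simp) x
    -- The head of the list is the outermost derivative, hence the first argument of the tensor.
    rw [List.ofFn_succ, listPartial_cons, iteratedFDeriv_succ_apply_left,
      partialDeriv_eq_fderiv (contDiff_listPartial hf _)]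
    simp only [funext (ih _)]
    rw [fderiv_continuousMultilinear_apply_const_apply hd]
    rfl

end Derivatives

/-! ### Derivatives of a product in separate variables. -/

section Product

variable {V : Type*} [DecidableEq V]

/-- Along this line the second factor is constant, so it factors out without any smoothness
assumption. -/
lemma partialDeriv_inl (v : V) (f g : (V → ℝ) → ℝ) :
    partialDeriv (Sum.inl v) (fun γ : V ⊕ V → ℝ => f (γ ∘ Sum.inl) * g (γ ∘ Sum.inr)) =
      fun γ => partialDeriv v f (γ ∘ Sum.inl) * g (γ ∘ Sum.inr) := by
  ext γ
  have h₁ (t : ℝ) : (γ + t • Pi.single (Sum.inl v) (1 : ℝ)) ∘ Sum.inl =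
      γ ∘ Sum.inl + t • Pi.single v (1 : ℝ) := by
    ext w; simp [Pi.single_apply]
  have h₂ (t : ℝ) : (γ + t • Pi.single (Sum.inl v) (1 : ℝ)) ∘ Sum.inr = γ ∘ Sum.inr := by
    ext w; simp
  simp [partialDeriv, lineDeriv, h₁, h₂]

lemma partialDeriv_inr (v : V) (f g : (V → ℝ) → ℝ) :
    partialDeriv (Sum.inr v) (fun γ : V ⊕ V → ℝ => f (γ ∘ Sum.inl) * g (γ ∘ Sum.inr)) =
      fun γ => f (γ ∘ Sum.inl) * partialDeriv v g (γ ∘ Sum.inr) := by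
  ext γ
  have h₁ (t : ℝ) : (γ + t • Pi.single (Sum.inr v) (1 : ℝ)) ∘ Sum.inr =
      γ ∘ Sum.inr + t • Pi.single v (1 : ℝ) := by
    ext w; simp [Pi.single_apply]
  have h₂ (t : ℝ) : (γ + t • Pi.single (Sum.inr v) (1 : ℝ)) ∘ Sum.inl = γ ∘ Sum.inl := by
    ext w; simp
  simp [partialDeriv, lineDeriv, h₁, h₂]

lemma listPartial_map_inl (l : List V) (f g : (V → ℝ) → ℝ) :
    listPartial (l.map Sum.inl) (fun γ : V ⊕ V → ℝ => f (γ ∘ Sum.inl) * g (γ ∘ Sum.inr)) =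
      fun γ => listPartial l f (γ ∘ Sum.inl) * g (γ ∘ Sum.inr) := by
  induction l with
  | nil => rfl
  | cons v l ih => rw [List.map_cons, listPartial_cons, ih, partialDeriv_inl, listPartial_cons]

lemma listPartial_map_inr (l : List V) (f g : (V → ℝ) → ℝ) :
    listPartial (l.map Sum.inr) (fun γ : V ⊕ V → ℝ => f (γ ∘ Sum.inl) * g (γ ∘ Sum.inr)) =
      fun γ => f (γ ∘ Sum.inl) * listPartial l g (γ ∘ Sum.inr) := by
  induction l with
  | nil => rfl
  | cons v l ih => rw [List.map_cons, listPartial_cons, ih, partialDeriv_inr, listPartial_cons]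

variable [Fintype V]

lemma variableList_sumElim_perm (m n : V → ℕ) :
    (variableList (Sum.elim m n)).Perm
      ((variableList m).map Sum.inl ++ (variableList n).map Sum.inr) := by
  have hc (k : V → ℕ) (v : V) : (variableList k).countP (fun w => decide (w = v)) = k v :=
    count_variableList k v
  refine variableList_perm ?_
  rintro (v | v) <;> simp [List.countP_map, Function.comp_def, hc]

lemma mixedPartial_mul {f g : (V → ℝ) → ℝ} (hf : ContDiff ℝ ⊤ f) (hg : ContDiff ℝ ⊤ g)
    (m n : V → ℕ) :
    mixedPartial (Sum.elim m n) (fun γ => f (γ ∘ Sum.inl) * g (γ ∘ Sum.inr)) 0 =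
      listPartial (variableList m) f 0 * listPartial (variableList n) g 0 := by
  have hl : ContDiff ℝ ⊤ fun γ : V ⊕ V → ℝ => γ ∘ Sum.inl :=
    contDiff_pi.2 fun v => contDiff_apply ℝ ℝ (Sum.inl v)
  have hr : ContDiff ℝ ⊤ fun γ : V ⊕ V → ℝ => γ ∘ Sum.inr :=
    contDiff_pi.2 fun v => contDiff_apply ℝ ℝ (Sum.inr v)
  rw [mixedPartial_eq_listPartial,
    listPartial_perm (f := fun γ => f (γ ∘ Sum.inl) * g (γ ∘ Sum.inr))
      ((hf.comp hl).mul (hg.comp hr)) (variableList_sumElim_perm m n),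
    listPartial_append, listPartial_map_inr, listPartial_map_inl]
  rfl

end Product

/-! ### Words and their letter counts. -/

section Counting

variable {V : Type*} [Fintype V] [DecidableEq V]

/-- Expand `(∑ v, X v) ^ N` word by word and by the multinomial theorem, then apply the linear
functional sending the monomial with exponent `m` to `w m`. -/
lemma sum_fun_count_ofFn (w : (V → ℕ) → ℝ) (N : ℕ) :
    ∑ i : Fin N → V, w (fun v => (List.ofFn i).count v) =
      ∑ n ∈ Finset.piAntidiag (Finset.univ : Finset V) N,
        (Nat.multinomial Finset.univ n : ℝ) * w n := by
  let Φ : MvPolynomial V ℝ →ₗ[ℝ] ℝ :=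
    (MvPolynomial.basisMonomials V ℝ).constr ℝ fun m => w m
  have hΦ (m : V →₀ ℕ) : Φ (MvPolynomial.monomial m 1) = w m := by
    have := (MvPolynomial.basisMonomials V ℝ).constr_basis ℝ (fun m => w m) m
    rwa [MvPolynomial.coe_basisMonomials] at this
  have h := (Fintype.sum_pow (fun v : V => (MvPolynomial.X v : MvPolynomial V ℝ)) N).symm.trans
    (Finset.sum_pow_eq_sum_piAntidiag _ _ _)
  apply_fun Φ at h
  rw [map_sum, map_sum] at h
  convert h using 2 with i _ n _
  · have : ∏ k, (MvPolynomial.X (i k) : MvPolynomial V ℝ) =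
        MvPolynomial.monomial (∑ k, Finsupp.single (i k) 1) 1 := by
      simp [MvPolynomial.X, MvPolynomial.monomial_sum_one]
    rw [this, hΦ]
    congr 1
    ext v
    rw [Finsupp.finsetSum_apply, ← Multiset.coe_count, ← Fin.univ_val_map, Multiset.count_map]
    simp [Finsupp.single_apply, eq_comm, Finset.card_def]
  · have : ∏ v, (MvPolynomial.X v : MvPolynomial V ℝ) ^ n v =
        MvPolynomial.monomial (Finsupp.equivFunOnFinite.symm n) 1 := by
      rw [MvPolynomial.monomial_eq, Finsupp.prod_fintype _ _ (by simp)]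
      simp
    rw [this, ← nsmul_eq_mul (Nat.multinomial _ _) (MvPolynomial.monomial _ _), map_nsmul, hΦ,
      nsmul_eq_mul]
    rfl

end Counting

/-! ### Orthogonal invariance. -/

section Orthogonal

variable {V W : Type*} [Fintype V] [Fintype W] [DecidableEq W]

/-- Expanding the rows of `O` in the standard basis gives a double sum over `j`, `j'`, whose cross
terms vanish because the columns of `O` are orthonormal. -/
lemma sum_sq_comp_orthogonal {N : ℕ} (T : MultilinearMap ℝ (fun _ : Fin N => W → ℝ) ℝ)
    {O : Matrix V W ℝ} (hO : Oᵀ * O = 1) :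
    ∑ i : Fin N → V, T (fun k => O (i k)) ^ 2 =
      ∑ j : Fin N → W, T (fun k => Pi.single (j k) 1) ^ 2 := by
  have hT (i : Fin N → V) : T (fun k => O (i k)) =
      ∑ j : Fin N → W, (∏ k, O (i k) (j k)) * T fun k => Pi.single (j k) 1 := by
    have hrow (v : V) : O v = ∑ w, O v w • (Pi.single w 1 : W → ℝ) := by
      ext w; simp [Finset.sum_apply, Pi.single_apply]
    conv_lhs => rw [funext fun k => hrow (i k)]
    rw [T.map_sum]
    exact Finset.sum_congr rfl fun j _ => T.map_smul_univ _ _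
  have horth (j j' : Fin N → W) :
      ∑ i : Fin N → V, (∏ k, O (i k) (j k)) * (∏ k, O (i k) (j' k)) = if j = j' then 1 else 0 := by
    simp_rw [← Finset.prod_mul_distrib]
    -- The sum over words `i` factors into one sum per position, each an entry of `Oᵀ * O`.
    rw [← Fintype.prod_sum fun k v => O v (j k) * O v (j' k)]
    have (k : Fin N) : ∑ v, O v (j k) * O v (j' k) = (1 : Matrix W W ℝ) (j k) (j' k) := by
      rw [← hO]; rfl
    simp_rw [this, Matrix.one_apply, Finset.prod_ite_zero, funext_iff]
    simp
  calc ∑ i : Fin N → V, T (fun k => O (i k)) ^ 2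
      = ∑ i : Fin N → V, ∑ j : Fin N → W, ∑ j' : Fin N → W,
          (∏ k, O (i k) (j k)) * (∏ k, O (i k) (j' k)) *
            (T (fun k => Pi.single (j k) 1) * T (fun k => Pi.single (j' k) 1)) := by
        refine Finset.sum_congr rfl fun i _ => ?_
        rw [hT, sq, Finset.sum_mul_sum]
        refine Finset.sum_congr rfl fun j _ => Finset.sum_congr rfl fun j' _ => by ring
    _ = ∑ j : Fin N → W, ∑ j' : Fin N → W,
          (if j = j' then 1 else 0) *
            (T (fun k => Pi.single (j k) 1) * T (fun k => Pi.single (j' k) 1)) := by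
        rw [Finset.sum_comm]
        refine Finset.sum_congr rfl fun j _ => ?_
        rw [Finset.sum_comm]
        refine Finset.sum_congr rfl fun j' _ => ?_
        rw [← Finset.sum_mul, horth]
    _ = _ := by simp [sq]

variable [DecidableEq V]

lemma sum_sq_iteratedFDeriv_comp_orthogonal {f : (W → ℝ) → ℝ} (hf : ContDiff ℝ ⊤ f)
    {O : Matrix V W ℝ} (hO : Oᵀ * O = 1) (N : ℕ) :
    ∑ i : Fin N → V,
        iteratedFDeriv ℝ N (fun x => f (Oᵀ *ᵥ x)) 0 (fun k => Pi.single (i k) 1) ^ 2 =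
      ∑ j : Fin N → W, iteratedFDeriv ℝ N f 0 (fun k => Pi.single (j k) 1) ^ 2 := by
  let L : (V → ℝ) →L[ℝ] (W → ℝ) := LinearMap.toContinuousLinearMap (Matrix.mulVecLin Oᵀ)
  refine Eq.trans ?_ (sum_sq_comp_orthogonal (iteratedFDeriv ℝ N f 0).toMultilinearMap hO)
  refine Finset.sum_congr rfl fun i _ => ?_
  have h := L.iteratedFDeriv_comp_right hf 0 (i := N) (by exact le_top)
  -- By the chain rule for a linear map, each basis vector is replaced by its image, a row of `O`.
  have hL (k : Fin N) : L (Pi.single (i k) 1) = O (i k) := by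
    ext w; simp [L]
  change iteratedFDeriv ℝ N (f ∘ L) 0 _ ^ 2 = _
  rw [h, ContinuousMultilinearMap.compContinuousLinearMap_apply, map_zero]
  simp only [hL]
  rfl

/-- Both matrices diagonalise to the same `D`, say `A = P D Pᵀ` and `B = Q D Qᵀ`; take `O = P Qᵀ`.
-/
lemma exists_orthogonal_conj_of_charpoly_eq {A B : Matrix V V ℝ} (hA : A.IsHermitian)
    (hB : B.IsHermitian) (h : A.charpoly = B.charpoly) :
    ∃ O : Matrix V V ℝ, Oᵀ * O = 1 ∧ A = O * B * Oᵀ := by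
  have hl := (hA.eigenvalues_eq_eigenvalues_iff hB).2 h
  have hA' := hA.spectral_theorem
  have hB' := hB.spectral_theorem
  rw [Unitary.conjStarAlgAut_apply] at hA' hB'
  rw [hl] at hA'
  generalize Matrix.diagonal (RCLike.ofReal ∘ hB.eigenvalues : V → ℝ) = D at hA' hB'
  generalize hA.eigenvectorUnitary = P at hA'
  generalize hB.eigenvectorUnitary = Q at hB'
  have hP := Unitary.coe_star_mul_self P
  have hQ := Unitary.coe_star_mul_self Q
  simp only [Matrix.star_eq_conjTranspose, Matrix.conjTranspose_eq_transpose_of_trivial] at *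
  generalize (P : Matrix V V ℝ) = P at *
  generalize (Q : Matrix V V ℝ) = Q at *
  refine ⟨P * Qᵀ, ?_, ?_⟩
  · rw [Matrix.transpose_mul, Matrix.transpose_transpose, Matrix.mul_assoc, ← Matrix.mul_assoc Pᵀ,
      hP, Matrix.one_mul, mul_eq_one_comm.1 hQ]
  · calc A = P * ((Qᵀ * Q) * D * (Qᵀ * Q)) * Pᵀ := by rw [hQ, hA']; simp
      _ = _ := by
        rw [hB', Matrix.transpose_mul, Matrix.transpose_transpose]; simp only [Matrix.mul_assoc]

/-- Both polynomials are monic and split over `ℝ`, so the roots determine them, including their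
degree. -/
lemma charpoly_eq_of_roots_eq {A : Matrix V V ℝ} {B : Matrix W W ℝ} (hA : A.IsHermitian)
    (hB : B.IsHermitian) (h : A.charpoly.roots = B.charpoly.roots) : A.charpoly = B.charpoly := by
  rw [hA.splits_charpoly.eq_prod_roots_of_monic A.charpoly_monic,
    hB.splits_charpoly.eq_prod_roots_of_monic B.charpoly_monic, h]

lemma exists_orthogonal_conj_of_roots_charpoly_eq {A : Matrix V V ℝ} {B : Matrix W W ℝ}
    (hA : A.IsHermitian) (hB : B.IsHermitian) (h : A.charpoly.roots = B.charpoly.roots) :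
    ∃ O : Matrix V W ℝ, Oᵀ * O = 1 ∧ A = O * B * Oᵀ := by
  have hch := charpoly_eq_of_roots_eq hA hB h
  have hcard : Fintype.card V = Fintype.card W := by
    rw [← A.charpoly_natDegree_eq_dim, hch, B.charpoly_natDegree_eq_dim]
  -- Any bijection serves: reindexing `B` along it keeps the characteristic polynomial, and the
  -- columns of `O` are relabelled by `W` afterwards.
  obtain e : V ≃ W := Fintype.equivOfCardEq hcard
  obtain ⟨O, hO, hAO⟩ := exists_orthogonal_conj_of_charpoly_eq hA (hB.submatrix e)
    (hch.trans (Matrix.charpoly_reindex e.symm B).symm)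
  refine ⟨O.submatrix id e.symm, ?_, ?_⟩
  · rw [Matrix.transpose_submatrix, ← Matrix.submatrix_mul Oᵀ O _ _ _ Function.bijective_id, hO,
      Matrix.submatrix_one_equiv]
  · rw [hAO]
    ext v v'
    simp only [Matrix.mul_apply, Matrix.submatrix_apply, Matrix.transpose_apply, id]
    rw [← e.sum_comp]
    refine Finset.sum_congr rfl fun x _ => ?_
    rw [← e.sum_comp]
    simp

lemma det_one_sub_conj {O : Matrix V W ℝ} (hO : Oᵀ * O = 1) (B : Matrix W W ℝ) :
    (1 - O * B * Oᵀ).det = (1 - B).det := by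
  rw [Matrix.mul_assoc, Matrix.det_one_sub_mul_comm, Matrix.mul_assoc, hO, Matrix.mul_one]

end Orthogonal

/-! ### The coarse-grained probability as a tensor norm. -/

section Coarse

variable {V W : Type*} [Fintype V] [Fintype W]

/-- The function `x ↦ exp (xᵀ A x / 2)`. -/
noncomputable def expQuadratic (A : Matrix V V ℝ) (x : V → ℝ) : ℝ :=
  Real.exp (1 / 2 * (x ⬝ᵥ (A *ᵥ x)))

lemma contDiff_expQuadratic (A : Matrix V V ℝ) : ContDiff ℝ ⊤ (expQuadratic A) := by
  unfold expQuadratic dotProduct Matrix.mulVec dotProduct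
  fun_prop

lemma expQuadratic_fromBlocks (A : Matrix V V ℝ) (γ : V ⊕ V → ℝ) :
    expQuadratic (Matrix.fromBlocks A 0 0 A) γ =
      expQuadratic A (γ ∘ Sum.inl) * expQuadratic A (γ ∘ Sum.inr) := by
  simp [expQuadratic, ← Real.exp_add, Matrix.fromBlocks_mulVec, dotProduct, mul_add]

lemma expQuadratic_conj (O : Matrix V W ℝ) (B : Matrix W W ℝ) (x : V → ℝ) :
    expQuadratic (O * B * Oᵀ) x = expQuadratic B (Oᵀ *ᵥ x) := by
  rw [expQuadratic, expQuadratic, ← Matrix.mulVec_mulVec, ← Matrix.mulVec_mulVec,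
    Matrix.dotProduct_mulVec, Matrix.mulVec_transpose]

variable [DecidableEq V]

/-- A Schur complement computation; if `1 - A * A` is singular, both sides are 0 by convention. -/
lemma det_sigmaQ_fromBlocks (A : Matrix V V ℝ) :
    (sigmaQ (Matrix.fromBlocks A 0 0 A)).det = ((1 - A * A).det)⁻¹ := by
  have : 1 - swapMatrix V * Matrix.fromBlocks A 0 0 A = Matrix.fromBlocks 1 (-A) (-A) 1 := by
    rw [swapMatrix, Matrix.fromBlocks_multiply, ← Matrix.fromBlocks_one, sub_eq_add_neg,
      Matrix.fromBlocks_neg, Matrix.fromBlocks_add]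
    simp
  rw [sigmaQ, this, Matrix.det_nonsing_inv, Matrix.det_fromBlocks_one₁₁, Ring.inverse_eq_inv']
  simp

lemma sum_detectionProb_fromBlocks (A : Matrix V V ℝ) (N : ℕ) :
    ∑ n ∈ Finset.piAntidiag (Finset.univ : Finset V) N,
        detectionProb (Matrix.fromBlocks A 0 0 A) n =
      1 / (N ! * √((1 - A * A).det)⁻¹) * ∑ i : Fin N → V,
        iteratedFDeriv ℝ N (expQuadratic A) 0 (fun k => Pi.single (i k) 1) ^ 2 := by
  have hF := contDiff_expQuadratic A
  have hsum : ∑ i : Fin N → V,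
      iteratedFDeriv ℝ N (expQuadratic A) 0 (fun k => Pi.single (i k) 1) ^ 2 =
      ∑ n ∈ Finset.piAntidiag (Finset.univ : Finset V) N,
        (Nat.multinomial Finset.univ n : ℝ) *
          listPartial (variableList n) (expQuadratic A) 0 ^ 2 := by
    rw [← sum_fun_count_ofFn fun n => listPartial (variableList n) (expQuadratic A) 0 ^ 2]
    refine Finset.sum_congr rfl fun i _ => ?_
    rw [← listPartial_ofFn hF i, listPartial_perm hF]
    exact (variableList_perm fun v => rfl).symm
  rw [hsum, Finset.mul_sum]
  refine Finset.sum_congr rfl fun n hn => ?_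
  have hmix : mixedPartial (Sum.elim n n) (fun γ =>
      Real.exp (1 / 2 * (γ ⬝ᵥ (Matrix.fromBlocks A 0 0 A *ᵥ γ)))) 0 =
      listPartial (variableList n) (expQuadratic A) 0 ^ 2 := by
    rw [sq, ← mixedPartial_mul hF hF]
    exact congrArg (fun f => mixedPartial (Sum.elim n n) f 0)
      (funext (expQuadratic_fromBlocks A))
  rw [detectionProb, det_sigmaQ_fromBlocks, hmix, ← mul_assoc]
  congr 1
  -- This turns the weight `1/n!` into `1/N!` times the multinomial coefficient.
  have hN : N ! = (∏ v, (n v)!) * Nat.multinomial Finset.univ n := by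
    rw [Nat.multinomial_spec, (Finset.mem_piAntidiag.1 hn).1]
  have hm : (Nat.multinomial Finset.univ n : ℝ) ≠ 0 := by
    exact_mod_cast (Nat.multinomial_pos _ _).ne'
  rw [hN, Nat.cast_mul, one_div_mul_eq_div, mul_right_comm, mul_comm _ (Nat.multinomial _ _ : ℝ),
    div_mul_cancel_left₀ hm, one_div]

end Coarse

lemma encoding_eq {V : Type*} [DecidableEq V] (G : SimpleGraph V) [DecidableRel G.Adj] (c : ℝ) :
    encoding G c = Matrix.fromBlocks (c • G.adjMatrix ℝ) 0 0 (c • G.adjMatrix ℝ) := by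
  simp [encoding, Matrix.fromBlocks_smul]

lemma isHermitian_adjMatrix {V : Type*} (G : SimpleGraph V) [DecidableRel G.Adj] :
    (G.adjMatrix ℝ).IsHermitian := by
  rw [Matrix.IsHermitian, Matrix.conjTranspose_eq_transpose_of_trivial,
    SimpleGraph.transpose_adjMatrix]

end GBS

theorem mainTheorem5 {V₁ V₂ : Type*} [Fintype V₁] [DecidableEq V₁] [Fintype V₂] [DecidableEq V₂]
    (G₁ : SimpleGraph V₁) [DecidableRel G₁.Adj] (G₂ : SimpleGraph V₂) [DecidableRel G₂.Adj]
    (hspec : GBS.Isospectral G₁ G₂)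
    (c : ℝ) (hc : 0 < c) (hc₁ : c * GBS.spectralNorm G₁ < 1) :
    ∀ N : ℕ, GBS.coarseProb G₁ c N = GBS.coarseProb G₂ c N := by
  intro N
  obtain ⟨O, hO, hG⟩ := GBS.exists_orthogonal_conj_of_roots_charpoly_eq
    (GBS.isHermitian_adjMatrix G₁) (GBS.isHermitian_adjMatrix G₂) hspec
  rw [GBS.coarseProb, GBS.coarseProb, GBS.encoding_eq, GBS.encoding_eq,
    GBS.sum_detectionProb_fromBlocks, GBS.sum_detectionProb_fromBlocks]
  have hA : c • G₁.adjMatrix ℝ = O * (c • G₂.adjMatrix ℝ) * Oᵀ := by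
    rw [hG, Matrix.mul_smul, Matrix.smul_mul]
  generalize c • G₁.adjMatrix ℝ = A at hA
  generalize c • G₂.adjMatrix ℝ = B at hA
  have hsq : A * A = O * (B * B) * Oᵀ := by
    calc A * A = O * B * (Oᵀ * O) * B * Oᵀ := by rw [hA]; simp only [Matrix.mul_assoc]
      _ = _ := by rw [hO, Matrix.mul_one, Matrix.mul_assoc O]
  rw [hsq, GBS.det_one_sub_conj hO, hA, funext (GBS.expQuadratic_conj O B),
    GBS.sum_sq_iteratedFDeriv_comp_orthogonal (GBS.contDiff_expQuadratic B) hO]
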